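/- Let $\Theta\subset\mathbb{R}^n$ and $\bar x\in\Theta$. Suppose that there are a neighborhood $O$ of $\bar x$, a map $\Phi:\mathbb{R}^n\to\mathbb{R}^m$ that is twice continuously differentiable around $\bar x$, and a polyhedral convex set $C\subset\mathbb{R}^m$ (a finite intersection of closed half-spaces) such that $$\Theta\cap O=\{x\in O : \Phi(x)\in C\}.$$ For a set $\Omega$ and $x\in\Omega$ let $T_\Omega(x)=\limsup_{t\searrow 0}(\Omega-x)/t$ be the tangent cone, let $\widehat N_\Omega(x)=\{v : \langle v,w\rangle\le 0 \text{ for all } w\in T_\Omega(x)\}$ be the regular normal cone, and let $N_\Omega(x)$ be the limiting normal cone, i.e. the set of all limits of sequences $v^k\in\widehat N_\Omega(x^k)$ with $x^k\in\Omega$, $x^k\to x$. Assume that $\bar v\in N_\Theta(\bar x)$ and that $$\operatorname{span}\{N_C(\Phi(\bar x))\}\cap\ker\nabla\Phi(\bar x)^*=\{0\}.$$ Let $P_\Theta$ denote the (set-valued) Euclidean projection mapping onto $\Theta$. Then the following conditions are equivalent: (a) there exists $\rho>0$ such that for every $r\in(0,1/\rho)$ the projection mapping $P_\Theta$ is single-valued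 and $\mathcal{C}^1$ in a neighborhood of $\bar x+r\bar v$; (b) there exists $\rho>0$ such that for every $r\in(0,1/\rho)$ the function $x\mapsto \operatorname{dist}(x,\Theta)^2$ is $\mathcal{C}^2$ in a neighborhood of $\bar x+r\bar v$; (c) $\bar v\in\operatorname{ri} N_\Theta(\bar x)$, where $\operatorname{ri}$ denotes the relative interior. -/

import Mathlib

open Filter Topology

/-- A polyhedral convex set: a finite intersection of closed half-spaces. -/
def IsPolyhedralConvex {E : Type*} [NormedAddCommGroup E] [InnerProductSpace ℝ E]
    (C : Set E) : Prop :=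
  ∃ (s : ℕ) (b : Fin s → E) (β : Fin s → ℝ), C = {z | ∀ i, inner ℝ (b i) z ≤ β i}

/-- The regular (Fréchet) normal cone: the polar of the tangent cone.
At a point of `Ω`, Mathlib's `posTangentConeAt Ω x` is the outer limit of
`(Ω - x) / t` as `t` decreases to `0`. -/
def regularNormalCone {E : Type*} [NormedAddCommGroup E] [InnerProductSpace ℝ E]
    (Ω : Set E) (x : E) : Set E :=
  {v | ∀ w ∈ posTangentConeAt Ω x, inner ℝ v w ≤ 0}

/-- The limiting (Mordukhovich) normal cone. -/
def limitingNormalCone {E : Type*} [NormedAddCommGroup E] [InnerProductSpace ℝ E]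
    (Ω : Set E) (x : E) : Set E :=
  {v | ∃ (xs vs : ℕ → E), (∀ k, xs k ∈ Ω) ∧ (∀ k, vs k ∈ regularNormalCone Ω (xs k)) ∧
    Tendsto xs atTop (𝓝 x) ∧ Tendsto vs atTop (𝓝 v)}

/-- The (set-valued) projection mapping: all nearest points of `Θ` to `u`. -/
def projectionSet {E : Type*} [PseudoMetricSpace E] (Θ : Set E) (u : E) : Set E :=
  {y | y ∈ Θ ∧ dist u y = Metric.infDist u Θ}

/-- The projection mapping onto `Θ` is single-valued and continuously differentiable
in a neighborhood of `u`. -/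
def ProjectionC1Near {E : Type*} [NormedAddCommGroup E] [InnerProductSpace ℝ E]
    (Θ : Set E) (u : E) : Prop :=
  ∃ U : Set E, IsOpen U ∧ u ∈ U ∧ ∃ p : E → E,
    (∀ x ∈ U, projectionSet Θ x = {p x}) ∧ ContDiffOn ℝ 1 p U

/-- The squared distance to `Θ` is twice continuously differentiable
in a neighborhood of `u`. -/
def SqDistC2Near {E : Type*} [NormedAddCommGroup E] [InnerProductSpace ℝ E]
    (Θ : Set E) (u : E) : Prop :=
  ∃ U : Set E, IsOpen U ∧ u ∈ U ∧ ContDiffOn ℝ 2 (fun x => Metric.infDist x Θ ^ 2) U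

/-! ### Squared distance versus nearest-point projection -/

section Distance

variable {E : Type*} [NormedAddCommGroup E] [InnerProductSpace ℝ E] {Θ : Set E}

/-! Near `xbar` only the active constraints count. Let `W` be the span of their normals and `G` the
orthogonal projection of `Φ` to `W`. The qualification condition makes `G` a submersion at `xbar`,
and locally `Θ` is `{G - G xbar ∈ K}` with `K` a pointed polyhedral cone in `W`. Hence, writing `A`
for the derivative of `G` at `xbar`, the limiting normal cone is the injective image under
`A.adjoint` of the polar of `K`, which spans `W`. So `vbar = A.adjoint l` is in the relative
interior iff `l` is interior to the polar (`limitingNormalCone_eq`,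
`adjoint_mem_intrinsicInterior_iff`).

A point `y ∈ Θ` displaced by `(fderiv ℝ G y).adjoint l`, with `l` a small complementary multiplier,
projects back to `y` (`exists_eventually_projectionSet_eq`). If `l` is interior, the inverse
function theorem solves the optimality system with `G y = G xbar`, giving a C¹ projection. If `l` is
a boundary point, it annihilates some nonzero `w ∈ K`. A curve in `Θ` with `G`-velocity `w` then
consists of projections, whereas differentiability of the projection `p` forces the derivative of `G
∘ p` to vanish.

The two smoothness conditions agree because the gradient of the squared distance is `2 (x - p x)`.
-/

theorem infDist_sq_add_le {x y h : E} (hy : y ∈ projectionSet Θ x) :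
    Metric.infDist (x + h) Θ ^ 2 ≤
      Metric.infDist x Θ ^ 2 + 2 * inner ℝ (x - y) h + ‖h‖ ^ 2 := by
  obtain ⟨hyΘ, hd⟩ := hy
  have h1 : Metric.infDist (x + h) Θ ≤ ‖(x - y) + h‖ := by
    have := Metric.infDist_le_dist_of_mem (x := x + h) hyΘ
    rwa [dist_eq_norm, show x + h - y = x - y + h by abel] at this
  have h2 := pow_le_pow_left₀ Metric.infDist_nonneg h1 2
  rw [norm_add_sq_real] at h2
  rwa [← hd, dist_eq_norm]

/-- Wherever the squared distance is differentiable, a nearest point determines its gradient. -/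
theorem fderiv_infDist_sq_of_mem_projectionSet {x y : E} {L : E →L[ℝ] ℝ}
    (hL : HasFDerivAt (fun x => Metric.infDist x Θ ^ 2) L x) (hy : y ∈ projectionSet Θ x) :
    L = (2 : ℝ) • innerSL ℝ (x - y) := by
  have hq : HasFDerivAt (fun z => ‖z - y‖ ^ 2) ((2 : ℝ) • innerSL ℝ (x - y)) x := by
    refine ((hasFDerivAt_id x).sub_const y).norm_sq.congr_fderiv ?_
    ext z
    simp
  -- The difference is nonnegative everywhere and zero at `x`, so its derivative vanishes there.
  have hmin : IsLocalMin (fun z => ‖z - y‖ ^ 2 - Metric.infDist z Θ ^ 2) x := by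
    refine Eventually.of_forall fun z => ?_
    have h0 : ‖x - y‖ ^ 2 - Metric.infDist x Θ ^ 2 = 0 := by
      rw [← hy.2, dist_eq_norm, sub_self]
    have h1 : Metric.infDist z Θ ≤ ‖z - y‖ := by
      rw [← dist_eq_norm]
      exact Metric.infDist_le_dist_of_mem hy.1
    have h2 := pow_le_pow_left₀ Metric.infDist_nonneg h1 2
    simp only [h0]
    linarith
  have := hmin.hasFDerivAt_eq_zero (hq.sub hL)
  exact (sub_eq_zero.mp this).symm

/-- The squared distance is differentiable where the projection is single-valued and continuous. -/
theorem hasFDerivAt_infDist_sq {x : E} {p : E → E}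
    (hp : ∀ᶠ z in 𝓝 x, p z ∈ projectionSet Θ z) (hc : ContinuousAt p x) :
    HasFDerivAt (fun x => Metric.infDist x Θ ^ 2) ((2 : ℝ) • innerSL ℝ (x - p x)) x := by
  have hpx := hp.self_of_nhds
  rw [hasFDerivAt_iff_isLittleO, Asymptotics.isLittleO_iff]
  intro c hc0
  have hc1 : Tendsto (fun z => ‖p z - p x‖) (𝓝 x) (𝓝 0) := by
    have := (hc.tendsto.sub_const (p x)).norm
    simpa using this
  have hc2 : Tendsto (fun z => ‖z - x‖) (𝓝 x) (𝓝 0) := by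
    have := ((continuous_id.sub continuous_const).norm (E := E)).tendsto' x 0
      (by simp : ‖id x - x‖ = 0)
    simpa using this
  filter_upwards [hp, hc1.eventually_lt_const (show (0 : ℝ) < c / 4 by positivity),
    hc2.eventually_lt_const (show (0 : ℝ) < c / 4 by positivity)] with z hz hz1 hz2
  -- The same upper estimate taken from `x` to `z` and from `z` to `x` bounds the remainder on both
  -- sides.
  have hu := infDist_sq_add_le (h := z - x) hpx
  have hl := infDist_sq_add_le (h := x - z) hz
  rw [show x + (z - x) = z by abel] at hu
  rw [show z + (x - z) = x by abel, norm_sub_rev x z] at hl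
  have e1 : inner ℝ (z - p z) (x - z) =
      - inner ℝ (x - p x) (z - x) - ‖z - x‖ ^ 2 + inner ℝ (p z - p x) (z - x) := by
    rw [show z - p z = (x - p x) + (z - x) - (p z - p x) by abel,
      show x - z = -(z - x) by abel, inner_neg_right, inner_sub_left, inner_add_left,
      real_inner_self_eq_norm_sq]
    ring
  rw [e1] at hl
  have h3 := (abs_le.mp (abs_real_inner_le_norm (p z - p x) (z - x)))
  have n0 := norm_nonneg (z - x)
  have h4 : ‖p z - p x‖ * ‖z - x‖ ≤ c / 4 * ‖z - x‖ := by gcongr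
  have h5 : ‖z - x‖ ^ 2 ≤ c / 4 * ‖z - x‖ := by rw [sq]; gcongr
  simp only [smul_apply, innerSL_apply_apply, smul_eq_mul]
  rw [Real.norm_eq_abs, abs_le]
  constructor <;> nlinarith

theorem ProjectionC1Near.sqDistC2Near {u : E} (h : ProjectionC1Near Θ u) : SqDistC2Near Θ u := by
  obtain ⟨U, hU, hu, p, hp, hpc⟩ := h
  refine ⟨U, hU, hu, ?_⟩
  have hd : ∀ x ∈ U, HasFDerivAt (fun x => Metric.infDist x Θ ^ 2)
      ((2 : ℝ) • innerSL ℝ (x - p x)) x := fun x hx =>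
    hasFDerivAt_infDist_sq
      (by filter_upwards [hU.mem_nhds hx] with z hz; rw [hp z hz]; rfl)
      (hpc.continuousOn.continuousAt (hU.mem_nhds hx))
  rw [show (2 : WithTop ℕ∞) = 1 + 1 by norm_num, contDiffOn_succ_iff_fderiv_of_isOpen hU]
  refine ⟨fun x hx => (hd x hx).differentiableAt.differentiableWithinAt, by simp, ?_⟩
  have : ContDiffOn ℝ 1 (fun x => (2 : ℝ) • innerSL ℝ (x - p x)) U :=
    ((innerSL ℝ (E := E)).contDiff.comp_contDiffOn (contDiffOn_id.sub hpc)).const_smul (2 : ℝ)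
  exact this.congr fun x hx => (hd x hx).fderiv

/-- The gradient formula forces every nearest point to be `x` minus half the gradient. This yields
uniqueness and smoothness but not existence, hence `hne`. -/
theorem SqDistC2Near.projectionC1Near [CompleteSpace E] {u : E} (h : SqDistC2Near Θ u)
    (hne : ∀ᶠ x in 𝓝 u, (projectionSet Θ x).Nonempty) : ProjectionC1Near Θ u := by
  obtain ⟨U, hU, hu, hc⟩ := h
  obtain ⟨V, hVs, hV, huV⟩ := mem_nhds_iff.mp hne
  refine ⟨U ∩ V, hU.inter hV, ⟨hu, huV⟩, fun x => x - (2 : ℝ)⁻¹ • (InnerProductSpace.toDual ℝ E).symm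
    (fderiv ℝ (fun x => Metric.infDist x Θ ^ 2) x), ?_, ?_⟩
  · rintro x ⟨hxU, hxV⟩
    have key : ∀ y ∈ projectionSet Θ x, y = x - (2 : ℝ)⁻¹ • (InnerProductSpace.toDual ℝ E).symm
        (fderiv ℝ (fun x => Metric.infDist x Θ ^ 2) x) := by
      intro y hy
      have hdiff : DifferentiableAt ℝ (fun x => Metric.infDist x Θ ^ 2) x :=
        (hc.differentiableOn (by norm_num)).differentiableAt (hU.mem_nhds hxU)
      have e := fderiv_infDist_sq_of_mem_projectionSet hdiff.hasFDerivAt hy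
      have e2 : (2 : ℝ) • innerSL ℝ (x - y) = InnerProductSpace.toDual ℝ E ((2 : ℝ) • (x - y)) := by
        ext z
        simp
      rw [e, e2, LinearIsometryEquiv.symm_apply_apply, smul_smul]
      norm_num
    obtain ⟨y, hy⟩ := hVs hxV
    refine Set.eq_singleton_iff_unique_mem.mpr ⟨?_, fun z hz => key z hz⟩
    simp only [← key y hy]
    exact hy
  · have h1 : ContDiffOn ℝ 1 (fderiv ℝ (fun x => Metric.infDist x Θ ^ 2)) (U ∩ V) := by
      rw [show (2 : WithTop ℕ∞) = 1 + 1 by norm_num, contDiffOn_succ_iff_fderiv_of_isOpen hU] at hc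
      exact hc.2.2.mono Set.inter_subset_left
    have h2 : ContDiff ℝ 1 (InnerProductSpace.toDual ℝ E).symm :=
      (InnerProductSpace.toDual ℝ E).symm.toContinuousLinearEquiv.contDiff
    exact contDiffOn_id.sub ((h2.comp_contDiffOn h1).const_smul _)

/-- Points near `xbar` have a nearest point in a set that is locally closed at `xbar`. -/
theorem eventually_projectionSet_nonempty [FiniteDimensional ℝ E] {xbar : E} (hx : xbar ∈ Θ)
    (hcl : ∃ δ > 0, IsClosed (Θ ∩ Metric.closedBall xbar δ)) :
    ∀ᶠ x in 𝓝 xbar, (projectionSet Θ x).Nonempty := by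
  obtain ⟨δ, hδ, hcl⟩ := hcl
  have hK : IsCompact (Θ ∩ Metric.closedBall xbar δ) := by
    have := (isCompact_closedBall xbar δ).inter_left hcl
    rwa [Set.inter_assoc, Set.inter_self] at this
  -- At radius `δ / 2`, any point outside the `δ`-ball is farther from `x` than `xbar` is.
  filter_upwards [Metric.ball_mem_nhds xbar (half_pos hδ)] with x hxb
  rw [Metric.mem_ball] at hxb
  obtain ⟨y, hy, hyd⟩ := hK.exists_infDist_eq_dist
    ⟨xbar, hx, Metric.mem_closedBall_self hδ.le⟩ x
  have hmin : ∀ z ∈ Θ, dist x y ≤ dist x z := by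
    intro z hz
    by_cases hzb : z ∈ Metric.closedBall xbar δ
    · rw [← hyd]
      exact Metric.infDist_le_dist_of_mem ⟨hz, hzb⟩
    · rw [Metric.mem_closedBall, not_le] at hzb
      have h1 : dist x y ≤ dist x xbar := by
        rw [← hyd]
        exact Metric.infDist_le_dist_of_mem ⟨hx, Metric.mem_closedBall_self hδ.le⟩
      have h2 := dist_triangle z x xbar
      rw [dist_comm z x] at h2
      linarith
  exact ⟨y, hy.1, le_antisymm ((Metric.le_infDist ⟨xbar, hx⟩).mpr fun {z} hz => hmin z hz)
    (Metric.infDist_le_dist_of_mem hy.1)⟩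

end Distance

/-! ### Lifting segments through a submersion -/

section Curves

variable {E F : Type*} [NormedAddCommGroup E] [NormedSpace ℝ E] [FiniteDimensional ℝ E]
  [NormedAddCommGroup F] [NormedSpace ℝ F] [FiniteDimensional ℝ F]

/-- A submersion lifts the segment in direction `A h` to a curve with initial velocity `h`. -/
theorem HasStrictFDerivAt.exists_curve {G : E → F} {A : E →L[ℝ] F} {x : E}
    (hG : HasStrictFDerivAt G A x) (hA : Function.Surjective A) (h : E) :
    ∃ y : ℝ → E, y 0 = x ∧ HasDerivAt y h 0 ∧ ∀ᶠ t in 𝓝 (0 : ℝ), G (y t) = G x + t • A h := by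
  have : CompleteSpace E := FiniteDimensional.complete ℝ E
  have : CompleteSpace F := FiniteDimensional.complete ℝ F
  have hA' : A.range = ⊤ := LinearMap.range_eq_top.mpr hA
  have hker : A.ker.ClosedComplemented := Submodule.ClosedComplemented.of_finiteDimensional_quotient
    A.isClosed_ker
  let φ := hG.implicitFunctionDataOfComplemented G A hA' hker
  have hφ := φ.hasStrictFDerivAt
  set e := φ.leftDeriv.equivProdOfSurjectiveOfIsCompl φ.rightDeriv φ.range_leftDeriv
    φ.range_rightDeriv φ.isCompl_ker with he
  let g := hφ.localInverse φ.prodFun e φ.pt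
  have hg : HasStrictFDerivAt g (e.symm : F × A.ker →L[ℝ] E) (φ.prodFun x) := hφ.to_localInverse
  have hl : HasDerivAt (fun t : ℝ => φ.prodFun x + t • e h) (e h) 0 := by
    simpa using ((hasDerivAt_id (0 : ℝ)).smul_const (e h)).const_add (φ.prodFun x)
  -- In the coordinates `(G, kernel component)` the curve is a straight line with direction `e h`,
  -- whose first component is `A h`.
  refine ⟨fun t => g (φ.prodFun x + t • e h), ?_, ?_, ?_⟩
  · simp only [zero_smul, add_zero]
    exact hφ.localInverse_apply_image
  · have hg' : HasFDerivAt g (e.symm : F × A.ker →L[ℝ] E) (φ.prodFun x + (0 : ℝ) • e h) := by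
      simpa using hg.hasFDerivAt
    have := hg'.comp_hasDerivAt (0 : ℝ) hl
    rwa [ContinuousLinearEquiv.coe_coe, e.symm_apply_apply] at this
  · have ht : Tendsto (fun t : ℝ => φ.prodFun x + t • e h) (𝓝 0) (𝓝 (φ.prodFun x)) := by
      simpa using hl.continuousAt.tendsto
    filter_upwards [ht.eventually hφ.eventually_right_inverse] with t ht
    exact congrArg Prod.fst ht

end Curves

/-! ### Tangent vectors, regular normals, and polar cones -/

section TangentNormal

variable {E F : Type*} [NormedAddCommGroup E] [InnerProductSpace ℝ E]
  [NormedAddCommGroup F] [InnerProductSpace ℝ F]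

theorem mem_posTangentConeAt_of_hasDerivAt {Ω : Set E} {x h : E} {y : ℝ → E} (hy0 : y 0 = x)
    (hy : HasDerivAt y h 0) (hΩ : ∀ᶠ t in 𝓝[>] (0 : ℝ), y t ∈ Ω) :
    h ∈ posTangentConeAt Ω x := by
  refine mem_tangentConeAt_of_seq (𝓝[>] (0 : ℝ)) (fun t => (t⁻¹).toNNReal) (fun t => y t - x)
    ?_ ?_ ?_
  · have := hy.continuousAt.tendsto.sub_const x
    rw [hy0, sub_self] at this
    exact this.mono_left nhdsWithin_le_nhds
  · simpa using hΩ
  · have := hy.tendsto_slope_zero_right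
    refine this.congr' ?_
    filter_upwards [self_mem_nhdsWithin] with t ht
    have : (0 : ℝ) ≤ t⁻¹ := (inv_pos.mpr ht).le
    rw [NNReal.smul_def, Real.coe_toNNReal _ this, zero_add, hy0]

theorem regularNormalCone_subset_limitingNormalCone {Ω : Set E} {x : E} (hx : x ∈ Ω) :
    regularNormalCone Ω x ⊆ limitingNormalCone Ω x := fun v hv =>
  ⟨fun _ => x, fun _ => v, fun _ => hx, fun _ => hv, tendsto_const_nhds, tendsto_const_nhds⟩

/-- The gradient of a function with a local maximum on `Ω` at `x` is a regular normal. -/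
theorem adjoint_mem_regularNormalCone [CompleteSpace E] [CompleteSpace F] {Ω : Set E} {x : E}
    {G : E → F} {A : E →L[ℝ] F} (hG : HasFDerivAt G A x) {l : F}
    (hl : ∀ᶠ z in 𝓝 x, z ∈ Ω → inner ℝ l (G z - G x) ≤ 0) :
    A.adjoint l ∈ regularNormalCone Ω x := by
  intro w hw
  have hf : HasFDerivAt (fun z => inner ℝ l (G z)) (innerSL ℝ l ∘L A) x :=
    (innerSL ℝ l).hasFDerivAt.comp x hG
  have hmax : IsLocalMaxOn (fun z => inner ℝ l (G z)) Ω x := by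
    rw [IsLocalMaxOn, IsMaxFilter, eventually_nhdsWithin_iff]
    filter_upwards [hl] with z hz hzΩ
    have := hz hzΩ
    rw [inner_sub_right] at this
    linarith
  have := hmax.hasFDerivWithinAt_nonpos hf.hasFDerivWithinAt hw
  rw [ContinuousLinearMap.adjoint_inner_left]
  simpa using this

variable {ι : Type*}

/-- The cone of the solutions of a system of homogeneous linear inequalities. -/
def inequalityCone (b : ι → F) : Set F := {z | ∀ i, inner ℝ (b i) z ≤ 0}

/-- The polar of a set. -/
def polarCone (K : Set F) : Set F := {l | ∀ z ∈ K, inner ℝ l z ≤ 0}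

variable {b : ι → F}

theorem zero_mem_inequalityCone : (0 : F) ∈ inequalityCone b := fun i => by simp

theorem add_smul_mem_inequalityCone {z w : F} (hz : z ∈ inequalityCone b)
    (hw : w ∈ inequalityCone b) {t : ℝ} (ht : 0 ≤ t) : z + t • w ∈ inequalityCone b := fun i => by
  rw [inner_add_right, inner_smul_right]
  have := mul_nonpos_of_nonneg_of_nonpos ht (hw i)
  linarith [hz i]

theorem isClosed_inequalityCone : IsClosed (inequalityCone b) := by
  have : inequalityCone b = ⋂ i, {z | inner ℝ (b i) z ≤ 0} := by
    ext z
    simp [inequalityCone]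
  rw [this]
  exact isClosed_iInter fun i => isClosed_le (by fun_prop) continuous_const

theorem eq_zero_of_inner_eq_zero (hb : Submodule.span ℝ (Set.range b) = ⊤) {z : F}
    (hz : ∀ i, inner ℝ (b i) z = 0) : z = 0 := by
  have h : Submodule.span ℝ (Set.range b) ≤ (innerSL ℝ z).ker := by
    rw [Submodule.span_le]
    rintro _ ⟨i, rfl⟩
    simpa [real_inner_comm] using hz i
  rw [hb] at h
  have : innerSL ℝ z z = 0 := h (Submodule.mem_top (x := z))
  simpa using this

theorem mem_polarCone_inequalityCone (i : ι) : b i ∈ polarCone (inequalityCone b) :=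
  fun _ hz => hz i

theorem isClosed_polarCone {K : Set F} : IsClosed (polarCone K) := by
  have : polarCone K = ⋂ z ∈ K, {l | inner ℝ l z ≤ 0} := by
    ext z
    simp [polarCone]
  rw [this]
  exact isClosed_iInter fun i => isClosed_iInter fun _ => isClosed_le (by fun_prop) continuous_const

theorem smul_mem_polarCone {K : Set F} {l : F} (hl : l ∈ polarCone K) {r : ℝ} (hr : 0 ≤ r) :
    r • l ∈ polarCone K := fun z hz => by
  rw [inner_smul_left]
  exact mul_nonpos_of_nonneg_of_nonpos hr (hl z hz)

theorem smul_mem_interior_polarCone {K : Set F} {l : F} (hl : l ∈ interior (polarCone K)) {r : ℝ}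
    (hr : 0 < r) : r • l ∈ interior (polarCone K) := by
  rw [mem_interior] at hl ⊢
  obtain ⟨U, hU, hUo, hlU⟩ := hl
  refine ⟨(fun z => r⁻¹ • z) ⁻¹' U, fun z hz => ?_, hUo.preimage (by fun_prop), ?_⟩
  · have := smul_mem_polarCone (hU hz) hr.le
    rwa [smul_smul, mul_inv_cancel₀ hr.ne', one_smul] at this
  · rwa [Set.mem_preimage, smul_smul, inv_mul_cancel₀ hr.ne', one_smul]

/-- A boundary point of the polar of a closed cone annihilates a nonzero element of the cone. -/
theorem exists_inner_eq_zero_of_notMem_interior [FiniteDimensional ℝ F] {l : F}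
    (hl : l ∈ polarCone (inequalityCone b)) (hl' : l ∉ interior (polarCone (inequalityCone b))) :
    ∃ w ∈ inequalityCone b, w ≠ 0 ∧ inner ℝ l w = 0 := by
  by_contra! hcon
  apply hl'
  have hS : IsCompact (inequalityCone b ∩ Metric.sphere (0 : F) 1) :=
    (isCompact_sphere (0 : F) 1).inter_left isClosed_inequalityCone
  -- Compactness makes the strict negativity uniform on unit vectors, so it survives perturbing `l`
  -- by less than `c`.
  have hc : ∃ c > 0, ∀ w ∈ inequalityCone b ∩ Metric.sphere (0 : F) 1, inner ℝ l w ≤ -c := by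
    rcases (inequalityCone b ∩ Metric.sphere (0 : F) 1).eq_empty_or_nonempty with h | h
    · exact ⟨1, one_pos, by simp [h]⟩
    · obtain ⟨w, hw, hmax⟩ := hS.exists_isMaxOn h
        (f := fun w => inner ℝ l w) (by fun_prop)
      have hw0 : w ≠ 0 := by
        rintro rfl
        simpa using hw.2
      have : inner ℝ l w < 0 := lt_of_le_of_ne (hl w hw.1) (hcon w hw.1 hw0)
      exact ⟨-inner ℝ l w, by linarith, fun z hz => by simpa using hmax hz⟩
  obtain ⟨c, hc0, hc⟩ := hc
  rw [mem_interior_iff_mem_nhds]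
  filter_upwards [Metric.ball_mem_nhds l hc0] with k hk z hz
  rcases eq_or_ne z 0 with rfl | hz0
  · simp
  have hn : 0 < ‖z‖ := norm_pos_iff.mpr hz0
  have hu : ‖z‖⁻¹ • z ∈ inequalityCone b ∩ Metric.sphere (0 : F) 1 := by
    refine ⟨?_, by simp [norm_smul, hn.ne']⟩
    have := add_smul_mem_inequalityCone (zero_mem_inequalityCone (b := b)) hz (inv_pos.mpr hn).le
    rwa [zero_add] at this
  have h1 := hc _ hu
  rw [inner_smul_right, inv_mul_le_iff₀ hn] at h1
  have h2 := real_inner_le_norm (k - l) z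
  rw [Metric.mem_ball, dist_eq_norm] at hk
  have h3 : ‖k - l‖ * ‖z‖ ≤ c * ‖z‖ := by gcongr
  rw [inner_sub_left] at h2
  linarith

end TangentNormal

/-! ### Normal cones of preimages under submersions -/

section LimitingNormal

variable {E F : Type*} [NormedAddCommGroup E] [InnerProductSpace ℝ E]
  [NormedAddCommGroup F] [InnerProductSpace ℝ F]

theorem tendsto_clm_apply {α : Type*} {f : Filter α} {B : α → E →L[ℝ] F} {B₀ : E →L[ℝ] F}
    {v : α → E} {v₀ : E} (hB : Tendsto B f (𝓝 B₀)) (hv : Tendsto v f (𝓝 v₀)) :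
    Tendsto (fun k => B k (v k)) f (𝓝 (B₀ v₀)) :=
  (isBoundedBilinearMap_apply.continuous.tendsto (B₀, v₀)).comp (hB.prodMk_nhds hv)

variable [FiniteDimensional ℝ F] [CompleteSpace F]

/-- Composing `B z` with a fixed right inverse of `B x` gives an operator near the identity, hence
invertible. -/
theorem eventually_surjective {X : Type*} [TopologicalSpace X] {B : X → E →L[ℝ] F} {x : X}
    (hB : ContinuousAt B x) (hs : Function.Surjective (B x)) :
    ∀ᶠ z in 𝓝 x, Function.Surjective (B z) := by
  obtain ⟨R, hR⟩ := (B x).toLinearMap.exists_rightInverse_of_surjective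
    (LinearMap.range_eq_top.mpr hs)
  let R' := LinearMap.toContinuousLinearMap R
  have h1 : B x ∘L R' = 1 := by
    ext z
    exact LinearMap.congr_fun hR z
  have hc : ContinuousAt (fun z => B z ∘L R') x := hB.clm_comp continuousAt_const
  have hu : ∀ᶠ T in 𝓝 (B x ∘L R'), IsUnit T := by
    rw [h1]
    exact Units.isOpen.mem_nhds isUnit_one
  filter_upwards [hc.eventually hu] with z hz y
  obtain ⟨u, hu⟩ := hz
  refine ⟨R' ((↑u⁻¹ : F →L[ℝ] F) y), ?_⟩
  have : ((u : F →L[ℝ] F) * (↑u⁻¹ : F →L[ℝ] F)) y = y := by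
    rw [Units.mul_inv]
    rfl
  rw [hu] at this
  exact this

variable [CompleteSpace E]

theorem exists_adjoint_comp_left_inverse {A : E →L[ℝ] F} (hA : Function.Surjective A) :
    ∃ L : E →L[ℝ] F, ∀ l, L (A.adjoint l) = l := by
  obtain ⟨R, hR⟩ := A.toLinearMap.exists_rightInverse_of_surjective (LinearMap.range_eq_top.mpr hA)
  refine ⟨(LinearMap.toContinuousLinearMap R).adjoint, fun l => ext_inner_right ℝ fun z => ?_⟩
  rw [ContinuousLinearMap.adjoint_inner_left, ContinuousLinearMap.adjoint_inner_left]
  congr 1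
  exact LinearMap.congr_fun hR z

/-- Both `u` and `-u` are admissible for `u ∈ ker A`, so `v` is orthogonal to the kernel and lies in
the range of the adjoint. -/
theorem exists_eq_adjoint_of_forall_inner_nonpos {A : E →L[ℝ] F} (hA : Function.Surjective A)
    {K : Set F} (hK : (0 : F) ∈ K) {v : E} (hv : ∀ h, A h ∈ K → inner ℝ v h ≤ 0) :
    ∃ l ∈ polarCone K, v = A.adjoint l := by
  have hker : v ∈ A.kerᗮ := by
    rw [Submodule.mem_orthogonal']
    intro u hu
    have hu' : A u = 0 := hu
    have h1 := hv u (by rwa [hu'])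
    have h2 := hv (-u) (by rwa [map_neg, hu', neg_zero])
    rw [inner_neg_right] at h2
    linarith
  rw [ContinuousLinearMap.orthogonal_ker] at hker
  rw [IsClosed.submodule_topologicalClosure_eq (Submodule.closed_of_finiteDimensional _)] at hker
  obtain ⟨l, rfl⟩ := hker
  refine ⟨l, fun z hz => ?_, rfl⟩
  obtain ⟨h, rfl⟩ := hA z
  have := hv h hz
  rwa [ContinuousLinearMap.coe_coe, ContinuousLinearMap.adjoint_inner_left] at this

variable {ι : Type*} {b : ι → F}

/-- The relative interior of the image of a spanning cone under an injective adjoint. -/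
theorem adjoint_mem_intrinsicInterior_iff {A : E →L[ℝ] F} (hA : Function.Surjective A)
    (hb : Submodule.span ℝ (Set.range b) = ⊤) {l : F} :
    A.adjoint l ∈ intrinsicInterior ℝ (A.adjoint '' polarCone (inequalityCone b)) ↔
      l ∈ interior (polarCone (inequalityCone b)) := by
  obtain ⟨L, hL⟩ := exists_adjoint_comp_left_inverse hA
  set N := A.adjoint '' polarCone (inequalityCone b) with hN
  have h0 : (0 : E) ∈ N := ⟨0, fun z _ => by simp, by simp⟩
  have hspan : (affineSpan ℝ N : Set E) = Submodule.span ℝ N := by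
    rw [← affineSpan_insert_zero, Set.insert_eq_of_mem h0]
  -- The polar contains the spanning vectors `b i`, so the affine span of `N` is the whole range of
  -- the adjoint. There `L` is a continuous inverse, and interiors correspond.
  have hmem : ∀ k, A.adjoint k ∈ affineSpan ℝ N := by
    intro k
    rw [← SetLike.mem_coe, hspan, SetLike.mem_coe]
    have h1 : (⊤ : Submodule ℝ F) ≤ (Submodule.span ℝ N).comap A.adjoint.toLinearMap := by
      rw [← hb, Submodule.span_le]
      rintro _ ⟨i, rfl⟩
      exact Submodule.subset_span ⟨b i, mem_polarCone_inequalityCone i, rfl⟩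
    exact h1 (Submodule.mem_top (x := k))
  have hran : ∀ y ∈ affineSpan ℝ N, A.adjoint (L y) = y := by
    intro y hy
    rw [← SetLike.mem_coe, hspan, SetLike.mem_coe] at hy
    have h1 : Submodule.span ℝ N ≤ A.adjoint.range := by
      rw [Submodule.span_le]
      rintro _ ⟨k, -, rfl⟩
      exact ⟨k, rfl⟩
    obtain ⟨k, rfl⟩ := h1 hy
    exact congrArg _ (hL k)
  rw [mem_intrinsicInterior]
  constructor
  · rintro ⟨y, hy, hyl⟩
    let f : F → affineSpan ℝ N := fun k => ⟨A.adjoint k, hmem k⟩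
    have hf : Continuous f := A.adjoint.continuous.subtype_mk _
    have hfl : f l = y := Subtype.ext hyl.symm
    rw [mem_interior]
    refine ⟨f ⁻¹' interior (((↑) : affineSpan ℝ N → E) ⁻¹' N), fun k hk => ?_,
      isOpen_interior.preimage hf, by rwa [Set.mem_preimage, hfl]⟩
    obtain ⟨k', hk', he⟩ := interior_subset hk
    have : k' = k := by rw [← hL k', ← hL k]; exact congrArg L he
    rwa [← this]
  · intro hl
    refine ⟨⟨A.adjoint l, hmem l⟩, ?_, rfl⟩
    rw [mem_interior]
    refine ⟨(fun y : affineSpan ℝ N => L y) ⁻¹' interior (polarCone (inequalityCone b)),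
      fun y hy => ⟨L y, interior_subset hy, hran y y.2⟩,
      isOpen_interior.preimage (L.continuous.comp continuous_subtype_val), ?_⟩
    simpa [hL l] using hl

variable [FiniteDimensional ℝ E]

variable {Θ : Set E} {G : E → F} {xbar : E}

theorem regularNormalCone_subset_of_submersion {x : E} (hG : HasStrictFDerivAt G (fderiv ℝ G x) x)
    (hs : Function.Surjective (fderiv ℝ G x)) (hx : G x - G xbar ∈ inequalityCone b)
    (hΘ : ∀ᶠ z in 𝓝 x, (z ∈ Θ ↔ G z - G xbar ∈ inequalityCone b)) {v : E}
    (hv : v ∈ regularNormalCone Θ x) :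
    ∃ l ∈ polarCone (inequalityCone b), v = (fderiv ℝ G x).adjoint l := by
  refine exists_eq_adjoint_of_forall_inner_nonpos hs zero_mem_inequalityCone fun h hh => hv h ?_
  obtain ⟨y, hy0, hy, hyG⟩ := hG.exists_curve hs h
  refine mem_posTangentConeAt_of_hasDerivAt hy0 hy ?_
  have ht : Tendsto y (𝓝 0) (𝓝 x) := hy0 ▸ hy.continuousAt.tendsto
  filter_upwards [nhdsWithin_le_nhds (ht.eventually hΘ), nhdsWithin_le_nhds hyG,
    self_mem_nhdsWithin] with t h1 h2 h3
  rw [h1, h2, add_sub_right_comm]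
  exact add_smul_mem_inequalityCone hx hh (le_of_lt h3)

/-- The limiting normal cone of the preimage of a closed convex cone under a submersion. -/
theorem limitingNormalCone_eq (hG : ContDiffAt ℝ 2 G xbar)
    (hs : Function.Surjective (fderiv ℝ G xbar)) (hx : xbar ∈ Θ)
    (hΘ : ∀ᶠ z in 𝓝 xbar, (z ∈ Θ ↔ G z - G xbar ∈ inequalityCone b)) :
    limitingNormalCone Θ xbar =
      (fderiv ℝ G xbar).adjoint '' polarCone (inequalityCone b) := by
  apply Set.Subset.antisymm
  · rintro v ⟨xs, vs, hxs, hvs, hxt, hvt⟩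
    have hcd : ContinuousAt (fderiv ℝ G) xbar :=
      (hG.fderiv_right (m := 1) (by norm_num)).continuousAt
    have hstrict : ∀ᶠ z in 𝓝 xbar, HasStrictFDerivAt G (fderiv ℝ G z) z := by
      filter_upwards [hG.eventually (by simp)] with z hz
      exact hz.hasStrictFDerivAt (by simp)
    have hex : ∀ᶠ k in atTop, ∃ l ∈ polarCone (inequalityCone b),
        vs k = (fderiv ℝ G (xs k)).adjoint l := by
      filter_upwards [hxt.eventually (eventually_surjective hcd hs), hxt.eventually hstrict,
        hxt.eventually hΘ.eventually_nhds] with k h1 h2 h3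
      exact regularNormalCone_subset_of_submersion h2 h1 (h3.self_of_nhds.mp (hxs k)) h3 (hvs k)
    obtain ⟨N, hN⟩ := eventually_atTop.mp hex
    choose! l hlK hl using hN
    obtain ⟨L, hL⟩ := exists_adjoint_comp_left_inverse hs
    have hB : Tendsto (fun k => (fderiv ℝ G (xs k)).adjoint) atTop
        (𝓝 (fderiv ℝ G xbar).adjoint) :=
      (ContinuousLinearMap.adjoint.continuous.tendsto _).comp (hcd.tendsto.comp hxt)
    -- Inverting these operators recovers the multipliers `l k` continuously from `vs k`, so they
    -- converge to `L v`.
    have hu : Tendsto (fun k => L ∘L (fderiv ℝ G (xs k)).adjoint) atTop (𝓝 1) := by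
      have h1 : L ∘L (fderiv ℝ G xbar).adjoint = 1 := by
        ext z
        exact hL z
      rw [← h1]
      exact ((ContinuousLinearMap.compL ℝ F E F L).continuous.tendsto _).comp hB
    have hinv : Tendsto (fun k => Ring.inverse (L ∘L (fderiv ℝ G (xs k)).adjoint)) atTop (𝓝 1) := by
      have := (NormedRing.inverse_continuousAt (1 : (F →L[ℝ] F)ˣ)).tendsto.comp hu
      rwa [Units.val_one, Ring.inverse_one] at this
    have hlt : Tendsto l atTop (𝓝 (L v)) := by
      have h1 : Tendsto (fun k => Ring.inverse (L ∘L (fderiv ℝ G (xs k)).adjoint) (L (vs k))) atTop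
          (𝓝 ((1 : F →L[ℝ] F) (L v))) := tendsto_clm_apply hinv ((L.continuous.tendsto v).comp hvt)
      refine h1.congr' ?_
      have hun : ∀ᶠ T in 𝓝 (1 : F →L[ℝ] F), IsUnit T := Units.isOpen.mem_nhds isUnit_one
      filter_upwards [hu.eventually hun, eventually_ge_atTop N] with k hk hkN
      have := Ring.inverse_mul_cancel _ hk
      rw [hl k hkN]
      exact DFunLike.congr_fun this (l k)
    refine ⟨L v, isClosed_polarCone.mem_of_tendsto hlt
      ((eventually_ge_atTop N).mono hlK), ?_⟩
    refine tendsto_nhds_unique (tendsto_clm_apply hB hlt) (hvt.congr' ?_)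
    filter_upwards [eventually_ge_atTop N] with k hk using hl k hk
  · rintro _ ⟨l, hl, rfl⟩
    refine regularNormalCone_subset_limitingNormalCone hx (adjoint_mem_regularNormalCone
      (hG.differentiableAt (by norm_num)).hasFDerivAt ?_)
    filter_upwards [hΘ] with z hz hzΘ using hl _ (hz.mp hzΘ)

end LimitingNormal

/-! ### Smoothness of the projection under a submersion -/

section Projection

theorem exists_forall_lt_one_div_iff {P : ℝ → Prop} :
    (∃ ρ : ℝ, 0 < ρ ∧ ∀ r : ℝ, 0 < r → r < 1 / ρ → P r) ↔ ∀ᶠ r in 𝓝[>] (0 : ℝ), P r := by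
  rw [eventually_nhdsWithin_iff, Metric.eventually_nhds_iff]
  constructor
  · rintro ⟨ρ, hρ, h⟩
    refine ⟨1 / ρ, by positivity, fun {r} hr hr0 => h r hr0 ?_⟩
    rw [Real.dist_eq, sub_zero] at hr
    exact (le_abs_self r).trans_lt hr
  · rintro ⟨ε, hε, h⟩
    refine ⟨1 / ε, by positivity, fun r hr0 hr => h ?_ hr0⟩
    rw [one_div_one_div] at hr
    rwa [Real.dist_eq, sub_zero, abs_of_pos hr0]

theorem projectionSet_eq_singleton {X : Type*} [PseudoMetricSpace X] {Θ : Set X} {x y : X} (hy : y ∈ Θ)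
    (h : ∀ z ∈ Θ, z ≠ y → dist x y < dist x z) : projectionSet Θ x = {y} := by
  have hd : dist x y = Metric.infDist x Θ := by
    refine le_antisymm ((Metric.le_infDist ⟨y, hy⟩).mpr fun {z} hz => ?_)
      (Metric.infDist_le_dist_of_mem hy)
    rcases eq_or_ne z y with rfl | hzy
    · exact le_rfl
    · exact (h z hz hzy).le
  refine Set.eq_singleton_iff_unique_mem.mpr ⟨⟨hy, hd⟩, fun z hz => ?_⟩
  by_contra hzy
  have := h z hz.1 hzy
  rw [hz.2, hd] at this
  exact lt_irrefl _ this

variable {E F : Type*} [NormedAddCommGroup E] [InnerProductSpace ℝ E]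
  [NormedAddCommGroup F] [InnerProductSpace ℝ F] {Θ : Set E} {G : E → F} {xbar : E}

theorem projectionC1Near_of_eventually {u : E} {p : E → E}
    (hp : ∀ᶠ x in 𝓝 u, projectionSet Θ x = {p x}) (hc : ContDiffAt ℝ 1 p u) :
    ProjectionC1Near Θ u := by
  obtain ⟨U, hU, hUo, hu⟩ := mem_nhds_iff.mp (hp.and (hc.eventually (by simp)))
  exact ⟨U, hUo, hu, p, fun x hx => (hU hx).1, fun x hx => (hU hx).2.contDiffWithinAt⟩

/-- A quadratic bound for the first-order Taylor remainder, uniform in the base point. -/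
theorem ContDiffAt.exists_norm_sub_sub_fderiv_le (hG : ContDiffAt ℝ 2 G xbar) :
    ∃ c ≥ 0, ∃ δ > 0, ∀ y ∈ Metric.ball xbar δ, ∀ z ∈ Metric.ball xbar δ,
      ‖G z - G y - fderiv ℝ G y (z - y)‖ ≤ c * ‖z - y‖ ^ 2 := by
  obtain ⟨c, s, hs, hc⟩ := (hG.fderiv_right (m := 1) (by norm_num)).exists_lipschitzOnWith
  have hd : ∀ᶠ z in 𝓝 xbar, DifferentiableAt ℝ G z :=
    (hG.eventually (by simp)).mono fun z hz => hz.differentiableAt (by norm_num)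
  obtain ⟨δ, hδ, hball⟩ := Metric.mem_nhds_iff.mp (inter_mem hs hd)
  refine ⟨c, c.2, δ, hδ, fun y hy z hz => ?_⟩
  have hseg : segment ℝ y z ⊆ Metric.ball xbar δ := (convex_ball xbar δ).segment_subset hy hz
  have := (convex_segment y z).norm_image_sub_le_of_norm_hasFDerivWithin_le' (f := G)
    (f' := fderiv ℝ G) (φ := fderiv ℝ G y) (C := c * ‖z - y‖)
    (fun w hw => (hball (hseg hw)).2.hasFDerivAt.hasFDerivWithinAt)
    (fun w hw => ?_) (left_mem_segment ℝ y z) (right_mem_segment ℝ y z)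
  · rwa [mul_assoc, ← sq] at this
  · refine (hc.norm_sub_le (hball (hseg hw)).1 (hball hy).1).trans ?_
    gcongr
    exact norm_sub_le_of_mem_segment hw

variable [CompleteSpace E] [CompleteSpace F] {ι : Type*} {b : ι → F}

/-- Moving from a point of the constraint set along a small normal vector does not change the
nearest point. -/
theorem exists_eventually_projectionSet_eq (hG : ContDiffAt ℝ 2 G xbar)
    (hΘ : ∀ᶠ z in 𝓝 xbar, (z ∈ Θ ↔ G z - G xbar ∈ inequalityCone b)) :
    ∃ ε > 0, ∀ᶠ y in 𝓝 xbar, y ∈ Θ → ∀ l ∈ polarCone (inequalityCone b), ‖l‖ < ε →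
      inner ℝ l (G y - G xbar) = 0 →
      projectionSet Θ (y + (fderiv ℝ G y).adjoint l) = {y} := by
  obtain ⟨c, hc, δ₁, hδ₁, hT⟩ := hG.exists_norm_sub_sub_fderiv_le
  obtain ⟨δ₂, hδ₂, hΘ⟩ := Metric.mem_nhds_iff.mp hΘ
  set δ := min δ₁ δ₂ with hδdef
  have hδ : 0 < δ := lt_min hδ₁ hδ₂
  set M := ‖fderiv ℝ G xbar‖ + 1 with hM
  have hM0 : 0 < M := by positivity
  have hbd : ∀ᶠ y in 𝓝 xbar, ‖fderiv ℝ G y‖ < M :=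
    (hG.fderiv_right (m := 1) (by norm_num)).continuousAt.norm.eventually_lt_const (by simp [hM])
  -- The first bound gives a displacement shorter than `δ / 4`, so points of `Θ` outside the
  -- `δ`-ball cannot compete. The second makes the Taylor error in `2⟨a, z - y⟩` smaller than `‖z -
  -- y‖ ^ 2`.
  refine ⟨min (δ / (4 * M)) (1 / (2 * (c + 1))), by positivity, ?_⟩
  filter_upwards [hbd, Metric.ball_mem_nhds xbar (half_pos hδ)] with y hyM hyb hyΘ l hl hlε hl0
  have hlε1 : ‖l‖ * (4 * M) < δ := (lt_div_iff₀ (by positivity)).mp (hlε.trans_le (min_le_left _ _))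
  have hlε2 : ‖l‖ * (2 * (c + 1)) < 1 :=
    (lt_div_iff₀ (by positivity)).mp (hlε.trans_le (min_le_right _ _))
  set a := (fderiv ℝ G y).adjoint l with ha
  have hanorm : ‖a‖ ≤ M * ‖l‖ := by
    refine ((fderiv ℝ G y).adjoint.le_opNorm l).trans ?_
    rw [LinearIsometryEquiv.norm_map]
    gcongr
  rw [Metric.mem_ball] at hyb
  refine projectionSet_eq_singleton hyΘ fun z hz hzy => ?_
  have hxy : dist (y + a) y = ‖a‖ := by simp [dist_eq_norm]
  rw [hxy]
  rcases lt_or_ge (dist z xbar) δ with hzb | hzb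
  · have h1 := hT y (Metric.mem_ball.mpr (by linarith [min_le_left δ₁ δ₂])) z
      (Metric.mem_ball.mpr (by linarith [min_le_left δ₁ δ₂]))
    have hzK : G z - G xbar ∈ inequalityCone b :=
      (hΘ (Metric.mem_ball.mpr (hzb.trans_le (min_le_right δ₁ δ₂)))).mp hz
    have h2 : inner ℝ a (z - y) ≤ ‖l‖ * (c * ‖z - y‖ ^ 2) := by
      rw [ha, ContinuousLinearMap.adjoint_inner_left]
      have e : fderiv ℝ G y (z - y) = (G z - G xbar) - (G y - G xbar)
          - (G z - G y - fderiv ℝ G y (z - y)) := by abel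
      rw [e, inner_sub_right, inner_sub_right, hl0]
      have h3 := hl _ hzK
      have h4 := (abs_le.mp (abs_real_inner_le_norm l (G z - G y - fderiv ℝ G y (z - y)))).1
      have h5 : ‖l‖ * ‖G z - G y - fderiv ℝ G y (z - y)‖ ≤ ‖l‖ * (c * ‖z - y‖ ^ 2) := by gcongr
      linarith
    have h6 : 0 < ‖z - y‖ ^ 2 := by
      have := norm_pos_iff.mpr (sub_ne_zero.mpr hzy)
      positivity
    rw [dist_eq_norm, show y + a - z = a - (z - y) by abel]
    refine lt_of_pow_lt_pow_left₀ 2 (norm_nonneg _) ?_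
    rw [norm_sub_sq_real]
    have h7 : 2 * (‖l‖ * c) < 1 := by nlinarith [norm_nonneg l]
    nlinarith
  · have h1 : dist z xbar ≤ dist (y + a) z + dist (y + a) y + dist y xbar := by
      have := dist_triangle4 z (y + a) y xbar
      rwa [dist_comm z (y + a)] at this
    rw [hxy] at h1
    nlinarith

/-- Taking adjoints, as a real continuous linear map. -/
noncomputable def adjointCLM (E F : Type*) [NormedAddCommGroup E] [InnerProductSpace ℝ E]
    [NormedAddCommGroup F] [InnerProductSpace ℝ F] [CompleteSpace E] [CompleteSpace F] :
    (E →L[ℝ] F) →L[ℝ] (F →L[ℝ] E) :=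
  LinearMap.mkContinuous
    { toFun := fun A => A.adjoint
      map_add' := fun A B => map_add _ A B
      map_smul' := fun c A => by simp } 1 fun A => by simp

theorem hasFDerivAt_add_adjoint (hG : ContDiffAt ℝ 2 G xbar) (l : F) :
    HasFDerivAt (fun p : E × F => p.1 + (fderiv ℝ G p.1).adjoint p.2)
      (ContinuousLinearMap.fst ℝ E F + ((fderiv ℝ G xbar).adjoint ∘L ContinuousLinearMap.snd ℝ E F +
        (adjointCLM E F ∘L fderiv ℝ (fderiv ℝ G) xbar ∘L ContinuousLinearMap.fst ℝ E F).flip l))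
      (xbar, l) := by
  have hD : HasFDerivAt (fderiv ℝ G) (fderiv ℝ (fderiv ℝ G) xbar) xbar :=
    ((hG.fderiv_right (m := 1) (by norm_num)).differentiableAt (by norm_num)).hasFDerivAt
  have h1 : HasFDerivAt (fun p : E × F => fderiv ℝ G p.1)
      (fderiv ℝ (fderiv ℝ G) xbar ∘L ContinuousLinearMap.fst ℝ E F) (xbar, l) :=
    HasFDerivAt.comp (xbar, l) (f := Prod.fst) hD hasFDerivAt_fst
  have h2 := (adjointCLM E F).hasFDerivAt.comp (xbar, l) h1
  exact hasFDerivAt_fst.add (h2.clm_apply hasFDerivAt_snd)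

theorem contDiffAt_add_adjoint (hG : ContDiffAt ℝ 2 G xbar) (l : F) :
    ContDiffAt ℝ 1 (fun p : E × F => p.1 + (fderiv ℝ G p.1).adjoint p.2) (xbar, l) := by
  have h1 : ContDiffAt ℝ 1 (fun p : E × F => fderiv ℝ G p.1) (xbar, l) :=
    ContDiffAt.comp (xbar, l) (f := Prod.fst) (hG.fderiv_right (m := 1) (by norm_num))
      contDiffAt_fst
  have h2 := (adjointCLM E F).contDiff.contDiffAt.comp (xbar, l) h1
  exact contDiffAt_fst.add (h2.clm_apply contDiffAt_snd)

variable [FiniteDimensional ℝ E] [FiniteDimensional ℝ F]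

/-- Invert `H (y, k) = (y + (fderiv ℝ G y).adjoint k, G y)` near `(xbar, l)` and freeze the second
output at `G xbar`. Interiority keeps the solved multiplier in the polar, and complementarity is
trivial since `G y = G xbar`. -/
theorem projectionC1Near_of_mem_interior (hG : ContDiffAt ℝ 2 G xbar)
    (hs : Function.Surjective (fderiv ℝ G xbar))
    (hΘ : ∀ᶠ z in 𝓝 xbar, (z ∈ Θ ↔ G z - G xbar ∈ inequalityCone b)) {ε : ℝ}
    (hε : ∀ᶠ y in 𝓝 xbar, y ∈ Θ → ∀ l ∈ polarCone (inequalityCone b), ‖l‖ < ε →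
      inner ℝ l (G y - G xbar) = 0 →
      projectionSet Θ (y + (fderiv ℝ G y).adjoint l) = {y})
    {l : F} (hl : l ∈ interior (polarCone (inequalityCone b))) (hlε : ‖l‖ < ε)
    (hlD : ‖fderiv ℝ (fderiv ℝ G) xbar‖ * ‖l‖ < 1) :
    ProjectionC1Near Θ (xbar + (fderiv ℝ G xbar).adjoint l) := by
  set A := fderiv ℝ G xbar with hA
  set D := fderiv ℝ (fderiv ℝ G) xbar with hD
  let H : E × F → E × F := fun p => (p.1 + (fderiv ℝ G p.1).adjoint p.2, G p.1)
  let f' : E × F →L[ℝ] E × F :=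
    (ContinuousLinearMap.fst ℝ E F + (A.adjoint ∘L ContinuousLinearMap.snd ℝ E F +
        (adjointCLM E F ∘L D ∘L ContinuousLinearMap.fst ℝ E F).flip l)).prod
      (A ∘L ContinuousLinearMap.fst ℝ E F)
  have hGd : HasFDerivAt G A xbar := (hG.differentiableAt (by norm_num)).hasFDerivAt
  have hH : HasFDerivAt H f' (xbar, l) := (hasFDerivAt_add_adjoint hG l).prodMk
    (HasFDerivAt.comp (xbar, l) (f := Prod.fst) hGd hasFDerivAt_fst)
  have hHc : ContDiffAt ℝ 1 H (xbar, l) := (contDiffAt_add_adjoint hG l).prodMk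
    (ContDiffAt.comp (xbar, l) (f := Prod.fst) (hG.of_le (by norm_num)) contDiffAt_fst)
  -- On the kernel `A h = 0`, so pairing the first equation with `h` removes the `k` term. Smallness
  -- of `l` against the second derivative then gives `h = 0`, and injectivity of the adjoint gives
  -- `k = 0`.
  have hinj : Function.Injective f' := by
    rw [injective_iff_map_eq_zero]
    rintro ⟨h, k⟩ hk
    have e1 : h + (A.adjoint k + (D h).adjoint l) = 0 := congrArg Prod.fst hk
    have e2 : A h = 0 := congrArg Prod.snd hk
    have e3 : ‖h‖ ^ 2 + inner ℝ l (D h h) = 0 := by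
      have := congrArg (fun v => inner ℝ v h) e1
      simpa [inner_add_left, ContinuousLinearMap.adjoint_inner_left, e2] using this
    have h0 : h = 0 := by
      by_contra hne
      have hpos := norm_pos_iff.mpr hne
      have b1 := (abs_le.mp (abs_real_inner_le_norm l (D h h))).1
      have b2 : ‖l‖ * ‖D h h‖ ≤ ‖l‖ * (‖D‖ * ‖h‖ * ‖h‖) := by
        gcongr
        exact D.le_opNorm₂ h h
      have b3 : (‖D‖ * ‖l‖) * ‖h‖ ^ 2 < 1 * ‖h‖ ^ 2 := by gcongr
      nlinarith
    subst h0
    obtain ⟨L, hL⟩ := exists_adjoint_comp_left_inverse hs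
    have : A.adjoint k = 0 := by simpa using e1
    have := hL k
    simp_all
  let e : (E × F) ≃L[ℝ] (E × F) :=
    (LinearEquiv.ofInjectiveEndo f'.toLinearMap hinj).toContinuousLinearEquiv
  have he : HasFDerivAt H (e : E × F →L[ℝ] E × F) (xbar, l) := hH
  let g := hHc.localInverse he one_ne_zero
  have hg : ContDiffAt ℝ 1 g (H (xbar, l)) := hHc.to_localInverse he one_ne_zero
  have hg0 : g (H (xbar, l)) = (xbar, l) := hHc.localInverse_apply_image he one_ne_zero
  have hgr : ∀ᶠ q in 𝓝 (H (xbar, l)), H (g q) = q :=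
    (hHc.hasStrictFDerivAt' he one_ne_zero).eventually_right_inverse
  have hq : ContDiffAt ℝ 1 (fun x : E => (x, G xbar)) (xbar + A.adjoint l) :=
    contDiffAt_id.prodMk contDiffAt_const
  have hgq : ContDiffAt ℝ 1 (fun x : E => g (x, G xbar)) (xbar + A.adjoint l) :=
    ContDiffAt.comp (xbar + A.adjoint l) hg hq
  have hgt : Tendsto (fun x : E => g (x, G xbar)) (𝓝 (xbar + A.adjoint l)) (𝓝 (xbar, l)) := by
    have := hgq.continuousAt.tendsto
    rwa [show g (xbar + A.adjoint l, G xbar) = (xbar, l) from hg0] at this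
  refine projectionC1Near_of_eventually (p := fun x => (g (x, G xbar)).1) ?_ hgq.fst
  have ht1 : Tendsto (fun x : E => (g (x, G xbar)).1) (𝓝 (xbar + A.adjoint l)) (𝓝 xbar) :=
    (continuous_fst.tendsto _).comp hgt
  have ht2 : Tendsto (fun x : E => (g (x, G xbar)).2) (𝓝 (xbar + A.adjoint l)) (𝓝 l) :=
    (continuous_snd.tendsto _).comp hgt
  filter_upwards [hq.continuousAt.tendsto.eventually hgr, ht1.eventually hε, ht1.eventually hΘ,
    ht2.eventually (isOpen_interior.mem_nhds hl), ht2.norm.eventually_lt_const hlε]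
    with x h1 h2 h3 h4 h5
  have e1 : (g (x, G xbar)).1 + (fderiv ℝ G (g (x, G xbar)).1).adjoint (g (x, G xbar)).2 = x :=
    congrArg Prod.fst h1
  have e2 : G (g (x, G xbar)).1 = G xbar := congrArg Prod.snd h1
  have := h2 (h3.mpr (by rw [e2, sub_self]; exact zero_mem_inequalityCone)) _
    (interior_subset h4) h5 (by rw [e2, sub_self, inner_zero_right])
  rwa [e1] at this

theorem mem_interior_of_projectionC1Near (hG : ContDiffAt ℝ 2 G xbar)
    (hs : Function.Surjective (fderiv ℝ G xbar)) (hb : Submodule.span ℝ (Set.range b) = ⊤)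
    (hΘ : ∀ᶠ z in 𝓝 xbar, (z ∈ Θ ↔ G z - G xbar ∈ inequalityCone b)) {ε : ℝ}
    (hε : ∀ᶠ y in 𝓝 xbar, y ∈ Θ → ∀ l ∈ polarCone (inequalityCone b), ‖l‖ < ε →
      inner ℝ l (G y - G xbar) = 0 →
      projectionSet Θ (y + (fderiv ℝ G y).adjoint l) = {y})
    {l : F} (hl : l ∈ polarCone (inequalityCone b)) (hlε : ‖l‖ < ε)
    (hP : ProjectionC1Near Θ (xbar + (fderiv ℝ G xbar).adjoint l)) :
    l ∈ interior (polarCone (inequalityCone b)) := by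
  by_contra hcon
  obtain ⟨w, hw, hw0, hlw⟩ := exists_inner_eq_zero_of_notMem_interior hl hcon
  set A := fderiv ℝ G xbar with hA
  set u := xbar + A.adjoint l with hu
  obtain ⟨U, hU, huU, p, hp, hpc⟩ := hP
  have hxΘ : xbar ∈ Θ := hΘ.self_of_nhds.mpr (by rw [sub_self]; exact zero_mem_inequalityCone)
  have hpu : p u = xbar := by
    have h1 := hε.self_of_nhds hxΘ l hl hlε (by simp)
    rw [← hA, ← hu, hp u huU] at h1
    exact Set.singleton_injective h1
  have hpd : HasFDerivAt p (fderiv ℝ p u) u :=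
    ((hpc.differentiableOn (by norm_num)).differentiableAt (hU.mem_nhds huU)).hasFDerivAt
  have hpt : Tendsto p (𝓝 u) (𝓝 xbar) := by
    have := hpd.continuousAt.tendsto
    rwa [hpu] at this
  have hGd : HasFDerivAt G A (p u) := by
    rw [hpu]
    exact (hG.differentiableAt (by norm_num)).hasFDerivAt
  -- Each active constraint holds along `p` and is attained with equality at `u`, so it has a local
  -- maximum there. The `b i` span, hence the full derivative vanishes.
  have hAP : ∀ h, A (fderiv ℝ p u h) = 0 := by
    intro h
    refine eq_zero_of_inner_eq_zero hb fun i => ?_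
    have hmax : IsLocalMax (fun x => inner ℝ (b i) (G (p x))) u := by
      filter_upwards [hU.mem_nhds huU, hpt.eventually hΘ] with x hxU hx
      have hxp : p x ∈ projectionSet Θ x := by rw [hp x hxU]; rfl
      have := hx.mp hxp.1 i
      rw [inner_sub_right] at this
      rw [hpu]
      linarith
    have hd : HasFDerivAt (fun x => inner ℝ (b i) (G (p x)))
        (innerSL ℝ (b i) ∘L (A ∘L fderiv ℝ p u)) u :=
      (innerSL ℝ (b i)).hasFDerivAt.comp u (hGd.comp u hpd)
    exact DFunLike.congr_fun (hmax.hasFDerivAt_eq_zero hd) h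
  obtain ⟨h, rfl⟩ := hs w
  obtain ⟨y, hy0, hy, hyG⟩ := (hG.hasStrictFDerivAt (by norm_num)).exists_curve hs h
  have hyt : Tendsto y (𝓝 0) (𝓝 xbar) := hy0 ▸ hy.continuousAt.tendsto
  let x : ℝ → E := fun t => y t + (fderiv ℝ G (y t)).adjoint l
  have hx0 : x 0 = u := by simp [x, hy0, hu, hA]
  obtain ⟨x', hx'⟩ : ∃ x', HasDerivAt x x' 0 := by
    have h1 : HasDerivAt (fun t => (y t, l)) (h, 0) 0 := hy.prodMk (hasDerivAt_const _ _)
    have h2 := hasFDerivAt_add_adjoint hG l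
    rw [← hy0] at h2
    exact ⟨_, HasFDerivAt.comp_hasDerivAt (0 : ℝ) (f := fun t => (y t, l)) h2 h1⟩
  have hpx : HasDerivAt (fun t => p (x t)) (fderiv ℝ p u x') 0 := by
    have h1 : HasFDerivAt p (fderiv ℝ p u) (x 0) := by rwa [hx0]
    exact h1.comp_hasDerivAt (0 : ℝ) hx'
  have hxt : Tendsto x (𝓝 0) (𝓝 u) := hx0 ▸ hx'.continuousAt.tendsto
  -- For `t ≥ 0` the displacement `t • w` stays in the cone and is annihilated by `l`, so `x t`
  -- projects to `y t`. Comparing right derivatives at `0` then gives `w = A h = 0`.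
  have heq : ∀ᶠ t in 𝓝[Set.Ici 0] (0 : ℝ), y t = p (x t) := by
    filter_upwards [nhdsWithin_le_nhds (hxt.eventually (hU.mem_nhds huU)),
      nhdsWithin_le_nhds (hyt.eventually hε), nhdsWithin_le_nhds (hyt.eventually hΘ),
      nhdsWithin_le_nhds hyG, self_mem_nhdsWithin] with t h1 h2 h3 h4 h5
    have h6 : G (y t) - G xbar = t • A h := by rw [h4, add_sub_cancel_left]
    have h7 : y t ∈ Θ := by
      rw [h3, h6, ← zero_add (t • A h)]
      exact add_smul_mem_inequalityCone zero_mem_inequalityCone hw h5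
    have h8 := h2 h7 l hl hlε (by rw [h6, inner_smul_right, hlw, mul_zero])
    rw [hp _ h1] at h8
    exact (Set.singleton_injective h8).symm
  have hyx : HasDerivWithinAt y (fderiv ℝ p u x') (Set.Ici 0) 0 :=
    hpx.hasDerivWithinAt.congr_of_eventuallyEq heq (heq.self_of_nhdsWithin Set.self_mem_Ici)
  have := (uniqueDiffWithinAt_Ici (0 : ℝ)).eq_deriv _ hyx hy.hasDerivWithinAt
  exact hw0 (by rw [← this, hAP])

/-- Smoothness of the projection onto the preimage of a pointed cone under a
submersion is characterized by relative interiority of the normal. -/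
theorem projection_tfae_of_submersion (hG : ContDiffAt ℝ 2 G xbar)
    (hs : Function.Surjective (fderiv ℝ G xbar)) (hb : Submodule.span ℝ (Set.range b) = ⊤)
    (hΘ : ∀ᶠ z in 𝓝 xbar, (z ∈ Θ ↔ G z - G xbar ∈ inequalityCone b))
    (hne : ∀ᶠ x in 𝓝 xbar, (projectionSet Θ x).Nonempty) {vbar : E}
    (hv : vbar ∈ limitingNormalCone Θ xbar) :
    List.TFAE [
      ∀ᶠ r in 𝓝[>] (0 : ℝ), ProjectionC1Near Θ (xbar + r • vbar),
      ∀ᶠ r in 𝓝[>] (0 : ℝ), SqDistC2Near Θ (xbar + r • vbar),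
      vbar ∈ intrinsicInterior ℝ (limitingNormalCone Θ xbar)] := by
  have hxΘ : xbar ∈ Θ := hΘ.self_of_nhds.mpr (by rw [sub_self]; exact zero_mem_inequalityCone)
  obtain ⟨ε, hε0, hε⟩ := exists_eventually_projectionSet_eq hG hΘ
  rw [limitingNormalCone_eq hG hs hxΘ hΘ] at hv ⊢
  obtain ⟨l, hl, rfl⟩ := hv
  rw [adjoint_mem_intrinsicInterior_iff hs hb]
  have hsmall : ∀ η > 0, ∀ c : ℝ, ∀ᶠ r in 𝓝[>] (0 : ℝ), c * ‖r • l‖ < η := by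
    intro η hη c
    have : Tendsto (fun r : ℝ => c * ‖r • l‖) (𝓝 0) (𝓝 0) :=
      Continuous.tendsto' (by fun_prop) _ _ (by simp)
    exact nhdsWithin_le_nhds (this.eventually_lt_const hη)
  tfae_have 1 → 2 := fun h => h.mono fun r hr => hr.sqDistC2Near
  tfae_have 2 → 1 := by
    intro h
    have ht : Tendsto (fun r : ℝ => xbar + r • (fderiv ℝ G xbar).adjoint l) (𝓝 0) (𝓝 xbar) :=
      Continuous.tendsto' (by fun_prop) _ _ (by simp)
    filter_upwards [h, nhdsWithin_le_nhds (ht.eventually hne.eventually_nhds)] with r h1 h2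
    exact h1.projectionC1Near h2
  tfae_have 1 → 3 := by
    intro h
    -- A single small `r` suffices, since the interior of the polar is invariant under positive
    -- scaling.
    obtain ⟨r, h1, h2, h3⟩ := (h.and ((hsmall ε hε0 1).and self_mem_nhdsWithin)).exists
    have hr : (0 : ℝ) < r := h3
    rw [← map_smul] at h1
    rw [one_mul] at h2
    have := smul_mem_interior_polarCone (mem_interior_of_projectionC1Near hG hs hb hΘ hε
      (smul_mem_polarCone hl hr.le) h2 h1) (inv_pos.mpr hr)
    rwa [smul_smul, inv_mul_cancel₀ hr.ne', one_smul] at this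
  tfae_have 3 → 1 := by
    intro h
    filter_upwards [hsmall ε hε0 1, hsmall 1 one_pos ‖fderiv ℝ (fderiv ℝ G) xbar‖,
      self_mem_nhdsWithin] with r h1 h2 h3
    rw [one_mul] at h1
    rw [← map_smul]
    exact projectionC1Near_of_mem_interior hG hs hΘ hε (smul_mem_interior_polarCone h h3) h1 h2
  tfae_finish

end Projection

/-! ### Reduction of the polyhedral constraint to a submersion -/

theorem mem_limitingNormalCone_of_active {F : Type*} [NormedAddCommGroup F] [InnerProductSpace ℝ F]
    [CompleteSpace F] {C : Set F} {z a : F} (hz : z ∈ C) (ha : ∀ y ∈ C, inner ℝ a y ≤ inner ℝ a z) :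
    a ∈ limitingNormalCone C z := by
  refine regularNormalCone_subset_limitingNormalCone hz ?_
  have := adjoint_mem_regularNormalCone (Ω := C) (hasFDerivAt_id z) (l := a)
    (Eventually.of_forall fun y hy => by
      have := ha y hy
      simp only [id, inner_sub_right]
      linarith)
  intro w hw
  simpa [ContinuousLinearMap.adjoint_inner_left] using this w hw

theorem exists_isClosed_inter_closedBall {E F : Type*} [NormedAddCommGroup E] [NormedSpace ℝ E]
    [NormedAddCommGroup F] [NormedSpace ℝ F] {Θ O : Set E} {Φ : E → F} {C : Set F} {xbar : E}
    (hO : O ∈ 𝓝 xbar) (hΦ : ContDiffAt ℝ 2 Φ xbar) (hC : IsClosed C)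
    (hΘ : Θ ∩ O = {x | x ∈ O ∧ Φ x ∈ C}) :
    ∃ δ > 0, IsClosed (Θ ∩ Metric.closedBall xbar δ) := by
  have hc : ∀ᶠ x in 𝓝 xbar, ContinuousAt Φ x :=
    (hΦ.eventually (by simp)).mono fun x hx => hx.continuousAt
  obtain ⟨δ, hδ, hball⟩ := Metric.nhds_basis_closedBall.mem_iff.mp (inter_mem hO hc)
  refine ⟨δ, hδ, ?_⟩
  have hon : ContinuousOn Φ (Metric.closedBall xbar δ) := fun x hx =>
    (hball hx).2.continuousWithinAt
  convert hon.preimage_isClosed_of_isClosed Metric.isClosed_closedBall hC using 1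
  ext x
  have key : x ∈ O → (x ∈ Θ ↔ Φ x ∈ C) := fun hx => by
    have := Set.ext_iff.mp hΘ x
    simp only [Set.mem_inter_iff, Set.mem_ofPred_eq] at this
    tauto
  constructor
  · rintro ⟨h1, h2⟩
    exact ⟨h2, (key (hball h2).1).mp h1⟩
  · rintro ⟨h1, h2⟩
    exact ⟨(key (hball h1).1).mpr h2, h1⟩

theorem IsPolyhedralConvex.isClosed {F : Type*} [NormedAddCommGroup F] [InnerProductSpace ℝ F]
    {C : Set F} (hC : IsPolyhedralConvex C) : IsClosed C := by
  obtain ⟨s, b, β, rfl⟩ := hC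
  rw [Set.ofPred_forall]
  exact isClosed_iInter fun i => isClosed_le (by fun_prop) continuous_const

theorem corollary4p8 {n m : ℕ}
    (Θ : Set (EuclideanSpace ℝ (Fin n))) (xbar vbar : EuclideanSpace ℝ (Fin n))
    (Φ : EuclideanSpace ℝ (Fin n) → EuclideanSpace ℝ (Fin m))
    (C : Set (EuclideanSpace ℝ (Fin m))) (O : Set (EuclideanSpace ℝ (Fin n)))
    (hx : xbar ∈ Θ)
    (hO : O ∈ 𝓝 xbar)
    (hΦ : ContDiffAt ℝ 2 Φ xbar)
    (hC : IsPolyhedralConvex C)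
    (hΘ : Θ ∩ O = {x | x ∈ O ∧ Φ x ∈ C})
    (hv : vbar ∈ limitingNormalCone Θ xbar)
    (hqc : Submodule.span ℝ (limitingNormalCone C (Φ xbar)) ⊓
      (ContinuousLinearMap.adjoint (fderiv ℝ Φ xbar)).ker = ⊥) :
    List.TFAE [
      ∃ ρ : ℝ, 0 < ρ ∧ ∀ r : ℝ, 0 < r → r < 1 / ρ → ProjectionC1Near Θ (xbar + r • vbar),
      ∃ ρ : ℝ, 0 < ρ ∧ ∀ r : ℝ, 0 < r → r < 1 / ρ → SqDistC2Near Θ (xbar + r • vbar),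
      vbar ∈ intrinsicInterior ℝ (limitingNormalCone Θ xbar)] := by
  have hne := eventually_projectionSet_nonempty hx
    (exists_isClosed_inter_closedBall hO hΦ hC.isClosed hΘ)
  obtain ⟨s, b, β, rfl⟩ := hC
  have hmem : ∀ x ∈ O, (x ∈ Θ ↔ ∀ i, inner ℝ (b i) (Φ x) ≤ β i) := fun x hx => by
    have := Set.ext_iff.mp hΘ x
    simp only [Set.mem_inter_iff, Set.mem_ofPred_eq] at this
    tauto
  have hxC := (hmem xbar (mem_of_mem_nhds hO)).mp hx
  let I := {i : Fin s // inner ℝ (b i) (Φ xbar) = β i}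
  let W := Submodule.span ℝ (Set.range fun i : I => b i)
  let c : I → W := fun i => ⟨b i, Submodule.subset_span ⟨i, rfl⟩⟩
  have hc : Submodule.span ℝ (Set.range c) = ⊤ := by
    refine Submodule.map_injective_of_injective W.subtype_injective ?_
    rw [Submodule.map_span, Submodule.map_top, Submodule.range_subtype, ← Set.range_comp]
    rfl
  have hWN : W ≤ Submodule.span ℝ
      (limitingNormalCone {z | ∀ i, inner ℝ (b i) z ≤ β i} (Φ xbar)) := by
    refine Submodule.span_mono ?_
    rintro _ ⟨i, rfl⟩
    refine mem_limitingNormalCone_of_active hxC fun y hy => ?_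
    rw [i.2]
    exact hy i
  let G : EuclideanSpace ℝ (Fin n) → W := fun x => W.orthogonalProjectionOnto (Φ x)
  have hG : ContDiffAt ℝ 2 G xbar := W.orthogonalProjectionOnto.contDiff.contDiffAt.comp xbar hΦ
  have hGd : fderiv ℝ G xbar = W.orthogonalProjectionOnto ∘L fderiv ℝ Φ xbar :=
    (W.orthogonalProjectionOnto.hasFDerivAt.comp xbar
      (hΦ.differentiableAt (by norm_num)).hasFDerivAt).fderiv
  -- The adjoint of the projection is the inclusion of `W`, and `W` lies in the span of the normal
  -- cone. The qualification condition therefore makes the adjoint of the derivative injective.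
  have hs : Function.Surjective (fderiv ℝ G xbar) := by
    have hker : (fderiv ℝ G xbar).adjoint.ker = ⊥ := by
      rw [hGd, ContinuousLinearMap.adjoint_comp, Submodule.adjoint_orthogonalProjectionOnto, eq_bot_iff]
      intro w hw
      have h1 : (w : EuclideanSpace ℝ (Fin m)) ∈ Submodule.span ℝ
          (limitingNormalCone {z | ∀ i, inner ℝ (b i) z ≤ β i} (Φ xbar)) ⊓
          (ContinuousLinearMap.adjoint (fderiv ℝ Φ xbar)).ker := ⟨hWN w.2, hw⟩
      rw [hqc] at h1
      exact Subtype.ext h1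
    rw [← ContinuousLinearMap.orthogonal_range, Submodule.orthogonal_eq_bot_iff] at hker
    exact LinearMap.range_eq_top.mp hker
  have hinner : ∀ (i : I) x, inner ℝ (c i) (G x - G xbar) =
      inner ℝ (b i) (Φ x) - β i := by
    intro i x
    rw [← i.2, ← inner_sub_right, ← map_sub, Submodule.inner_orthogonalProjectionOnto_eq_of_mem_left]
  have hloc : ∀ᶠ x in 𝓝 xbar, (x ∈ Θ ↔ G x - G xbar ∈ inequalityCone c) := by
    -- Inactive constraints are strict at `xbar` and remain so nearby by continuity.
    have hin : ∀ᶠ x in 𝓝 xbar, ∀ i, inner ℝ (b i) (Φ xbar) ≠ β i →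
        inner ℝ (b i) (Φ x) < β i := by
      refine eventually_all.mpr fun i => ?_
      by_cases hi : inner ℝ (b i) (Φ xbar) = β i
      · exact Eventually.of_forall fun x h => absurd hi h
      · have hcont : ContinuousAt (fun x => inner ℝ (b i) (Φ x)) xbar :=
          continuousAt_const.inner hΦ.continuousAt
        exact (hcont.tendsto.eventually_lt_const (lt_of_le_of_ne (hxC i) hi)).mono
          fun x hx _ => hx
    filter_upwards [hO, hin] with x hxO hxi
    rw [hmem x hxO]
    constructor
    · intro h i
      rw [hinner]
      linarith [h i]
    · intro h i
      by_cases hi : inner ℝ (b i) (Φ xbar) = β i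
      · have := h ⟨i, hi⟩
        rw [hinner] at this
        linarith
      · exact (hxi i hi).le
  rw [exists_forall_lt_one_div_iff, exists_forall_lt_one_div_iff]
  exact projection_tfae_of_submersion hG hs hc hloc hne hv
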